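/- For a finite set $P\subset\mathbb{R}^2$ in general position, a peeling sequence of $P$ is an ordering of its points obtained by repeatedly removing a vertex of the convex hull of the remaining points; let $g(P)$ be the number of peeling sequences of $P$. Three-ray sets. For $n\ge 3$ let $n=n_1+n_2+n_3$ with $n_1\ge n_2\ge n_3$ and each $n_i\in\{\lfloor n/3\rfloor,\lceil n/3\rceil\}$. Let $S_1$ be a single point, $S_1=\{0\}$, and $S_2=\{0,u\}$ with $u>0$ on the $x$-axis. For $n\ge3$, let $r_1,r_2,r_3$ be rays from the origin at mutual angles of $120^\circ$, in clockwise order, with $r_1$ the positive $x$-axis. On each ray $r_i$ place a copy of $S_{n_i}$, rotated so that the positive $x$-direction of $S_{n_i}$ becomes the direction of $r_i$, and translated so that its origin goes to the point of $r_i$ at distance $d_{n,i}>0$ from the origin; here $d_{n,i}$ is at least twice the distance of any point of $S_{n_i}$ from its origin, and all points of the first copy have larger $x$-coordinates than all points of the second, which in turn have larger $x$-coordinates than all points of the third. Let $S_n$ be the image of the union of the three copies under $(x,y)\mapsto(x,\varepsilon_n y)$, with $\varepsilon_n>0$. The construction is called $\eta$-flat, for a sequence $\eta=(\eta_n)$ of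 positive numbers, if for every $n$ all points of $S_n$ are within $\eta_n$ times the minimal distance of $S_n$ from the $x$-axis. For $n\ge 6$, a set $B_n$ is obtained from $S_n$ by picking one of the rays $r_i$ and removing the two smallest of its subrays (with ties broken arbitrarily), where a subray is one of the three rays of the copy of $S_{n_i}$ on $r_i$. (If $n_i=2$, the subrays are the two single points of the copy and the empty set.) Theorem. There are $u$ and distances $d_{n,i}$ such that for every positive sequence $\eta$ there are $\varepsilon_n$ that make the construction valid and $\eta$-flat. Moreover, for any $u$ and distances $d_{n,i}$ there is a positive sequence $\eta$ such that for every choice of $\varepsilon_n$ for which the construction is valid and $\eta$-flat (that is, whenever the flattening is sufficiently strong), and for all $n\ge6$, $$g(S_n)\le\frac{9.78^n}{500}\qquad\text{and}\qquad g(B_n)\le\frac{8.67^n}{500}$$ for every set $B_n$. -/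

import Mathlib

/-! The plane is `ℂ`, as a real vector space. -/

/-- `IsPeeling P l`: the list `l` is a peeling sequence of `P`, i.e. it lists the points of `P`, and
each point is a vertex (extreme point) of the convex hull of the points not yet removed. -/
inductive IsPeeling : Set ℂ → List ℂ → Prop
  | nil : IsPeeling ∅ []
  | cons (P : Set ℂ) (p : ℂ) (l : List ℂ) (hP : p ∈ P)
      (hull : p ∈ (convexHull ℝ P).extremePoints ℝ) (rest : IsPeeling (P \ {p}) l) :
      IsPeeling P (p :: l)

/-- The number `g(P)` of peeling sequences of `P`. -/
noncomputable def peelingCount (P : Set ℂ) : ℕ :=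
  {l : List ℂ | IsPeeling P l}.ncard

/-- The sizes `n₁ ≥ n₂ ≥ n₃` (indexed by `0, 1, 2`) with sum `n`, each of them `⌊n/3⌋` or
`⌈n/3⌉`. -/
def part (n : ℕ) (i : Fin 3) : ℕ := (n + 2 - (i : ℕ)) / 3

theorem part_lt (n : ℕ) (i : Fin 3) : part (n + 3) i < n + 3 := by
  unfold part
  omega

/-- Unit direction of the ray `i`: the rays are at mutual angles of 120 degrees, in clockwise
order, and ray `0` is the positive real axis. -/
noncomputable def rayDir (i : Fin 3) : ℂ :=
  Complex.exp (-((2 * Real.pi * (i : ℕ) / 3 : ℝ) : ℂ) * Complex.I)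

/-- The flattening `(x, y) ↦ (x, ε y)`. -/
def flatten (ε : ℝ) (z : ℂ) : ℂ := ⟨z.re, ε * z.im⟩

/-- The rotation followed by a translation that takes the origin to the point of ray `i` at
distance `r` from the origin, and the direction of the positive real axis to that of ray `i`. -/
noncomputable def placeOnRay (i : Fin 3) (r : ℝ) (z : ℂ) : ℂ := rayDir i * ((r : ℂ) + z)

/-- The sets `S n`, normalized so that the base point of `S n` is the origin and its direction is
that of the positive real axis. The parameters are the second point `u` of `S 2`, the distances
`d n i` at which the copies are placed, and the flattening factors `ε n`. -/
noncomputable def raySet (u : ℝ) (d : ℕ → Fin 3 → ℝ) (ε : ℕ → ℝ) : ℕ → Set ℂ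
  | 0 => ∅
  | 1 => {0}
  | 2 => {0, (u : ℂ)}
  | n + 3 => flatten (ε (n + 3)) ''
      ⋃ i : Fin 3, placeOnRay i (d (n + 3) i) '' raySet u d ε (part (n + 3) i)
termination_by n => n
decreasing_by exact part_lt n i

/-- The placed, not yet flattened copy of `S (part n i)` on ray `i`, in the construction of
`S n`. -/
noncomputable def placedCopy (u : ℝ) (d : ℕ → Fin 3 → ℝ) (ε : ℕ → ℝ) (n : ℕ) (i : Fin 3) :
    Set ℂ :=
  placeOnRay i (d n i) '' raySet u d ε (part n i)

/-- The part of `S n` on ray `i`; it has `part n i` points. The starting sets `S 1` and `S 2` are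
split into single points. -/
noncomputable def mainRay (u : ℝ) (d : ℕ → Fin 3 → ℝ) (ε : ℕ → ℝ) : ℕ → Fin 3 → Set ℂ
  | 0, _ => ∅
  | 1, i => ![{0}, ∅, ∅] i
  | 2, i => ![{(u : ℂ)}, {0}, ∅] i
  | n + 3, i => flatten (ε (n + 3)) '' placedCopy u d ε (n + 3) i

/-- The subray `j` of ray `i` of `S n` (for `3 ≤ n`): the ray `j` of the copy of `S (part n i)`
that sits on ray `i`; it has `part (part n i) j` points. -/
noncomputable def subray (u : ℝ) (d : ℕ → Fin 3 → ℝ) (ε : ℕ → ℝ) (n : ℕ) (i j : Fin 3) : Set ℂ :=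
  flatten (ε n) '' (placeOnRay i (d n i) '' mainRay u d ε (part n i) j)

/-- The set obtained from `S n` by removing from ray `i` all subrays except the subray `k`. -/
noncomputable def raySetB (u : ℝ) (d : ℕ → Fin 3 → ℝ) (ε : ℕ → ℝ) (n : ℕ) (i k : Fin 3) : Set ℂ :=
  raySet u d ε n \ ⋃ j ∈ {j : Fin 3 | j ≠ k}, subray u d ε n i j

/-- `IsB u d ε n B`: `B` is one of the sets `B n`, obtained from `S n` by picking a ray `i` and
removing the two smallest of its subrays, i.e. all but a subray `k` of largest size. -/
def IsB (u : ℝ) (d : ℕ → Fin 3 → ℝ) (ε : ℕ → ℝ) (n : ℕ) (B : Set ℂ) : Prop :=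
  ∃ i k : Fin 3, (∀ j : Fin 3, part (part n i) j ≤ part (part n i) k) ∧ B = raySetB u d ε n i k

/-- All points of `P` are within `η` times the minimal distance of `P` from the real axis. -/
def IsFlat (η : ℝ) (P : Set ℂ) : Prop :=
  ∀ p ∈ P, ∀ q ∈ P, ∀ q' ∈ P, q ≠ q' → |p.im| ≤ η * ‖q - q'‖

/-- The parameters `u`, `d`, `ε` give a valid three-ray construction in which `S n` is flat with
tolerance `η n`. -/
structure IsConstruction (u : ℝ) (d : ℕ → Fin 3 → ℝ) (ε η : ℕ → ℝ) : Prop where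
  u_pos : 0 < u
  d_pos : ∀ n, 3 ≤ n → ∀ i, 0 < d n i
  eps_pos : ∀ n, 3 ≤ n → 0 < ε n
  /-- The copies are placed far from the origin, compared to their size. -/
  far : ∀ n, 3 ≤ n → ∀ i, ∀ z ∈ raySet u d ε (part n i), 2 * ‖z‖ ≤ d n i
  /-- The copy on ray `0` is to the right of the copy on ray `1`. -/
  order_zero_one : ∀ n, 3 ≤ n →
    ∀ z ∈ placedCopy u d ε n 0, ∀ w ∈ placedCopy u d ε n 1, w.re < z.re
  /-- The copy on ray `1` is to the right of the copy on ray `2`. -/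
  order_one_two : ∀ n, 3 ≤ n →
    ∀ z ∈ placedCopy u d ε n 1, ∀ w ∈ placedCopy u d ε n 2, w.re < z.re
  flat : ∀ n, IsFlat (η n) (raySet u d ε n)

/-! Both bounds follow from one estimate on all subsets: for `n ≥ 6`, every `Q ⊆ S n` has at most `2
^ #Q * 4.335 ^ n / 500` peeling sequences. As `2 * 4.335 = 8.67`, this gives `8.67 ^ n / 500` for `S
n` itself and for each of its subsets, in particular for every `B n`.

The geometric input is `IsConstruction.vertices_subset`: as long as each of the three rays carries a
remaining point, only the outermost point of each ray can be a hull vertex. Flatness of the copies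
puts every other point into the triangle of these three. So there are at most three choices per step
until some ray is exhausted. After that, `peelingCount_union_le` bounds the count for the other two
rays by the product of their own counts times a power of 2 for the interleaving. The function
`rayWeight` solves the three-term recurrence and dominates these boundary values, so it bounds the
count throughout (`IsConstruction.peelingCount_le_rayWeight`).

This bounds subsets of `S n` in terms of subsets of the three smaller sets.
`IsConstruction.peelingBound` iterates it, with factorials for small sizes. Existence of the
construction is separate: with rapidly growing placement distances, the flattening factors are
chosen recursively. -/

/-! ### Counting peeling sequences: recurrence, unions, affine images. -/

theorem isPeeling_cons_iff {P : Set ℂ} {p : ℂ} {l : List ℂ} :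
    IsPeeling P (p :: l) ↔ p ∈ (convexHull ℝ P).extremePoints ℝ ∧ IsPeeling (P \ {p}) l := by
  constructor
  · rintro (_ | ⟨_, _, _, _, h, h'⟩)
    exact ⟨h, h'⟩
  · rintro ⟨h, h'⟩
    exact .cons P p l (extremePoints_convexHull_subset h) h h'

theorem isPeeling_empty_iff {l : List ℂ} : IsPeeling ∅ l ↔ l = [] := by
  constructor
  · rintro (_ | ⟨_, _, _, h, _, _⟩)
    · rfl
    · exact h.elim
  · rintro rfl
    exact .nil

theorem peelingCount_empty : peelingCount ∅ = 1 := by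
  simp [peelingCount, isPeeling_empty_iff]

theorem setOf_isPeeling_eq {P : Set ℂ} (hP : P.Nonempty) :
    {l | IsPeeling P l} =
      ⋃ v ∈ (convexHull ℝ P).extremePoints ℝ, List.cons v '' {l | IsPeeling (P \ {v}) l} := by
  ext l
  cases l with
  | nil =>
    simp only [Set.mem_ofPred_eq, Set.mem_iUnion, Set.mem_image, reduceCtorEq, and_false,
      exists_false, iff_false]
    intro h
    cases h
    exact Set.not_nonempty_empty hP
  | cons p l => simp [isPeeling_cons_iff, and_comm]

theorem ncard_diff_singleton_lt {P : Set ℂ} (hP : P.Finite) {v : ℂ} (hv : v ∈ P) :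
    (P \ {v}).ncard < P.ncard :=
  Set.ncard_sdiff_singleton_lt_of_mem hv hP

theorem finite_setOf_isPeeling {P : Set ℂ} (hP : P.Finite) : {l | IsPeeling P l}.Finite := by
  induction h : P.ncard using Nat.strong_induction_on generalizing P with
  | _ k ih =>
    rcases P.eq_empty_or_nonempty with rfl | hne
    · simp [isPeeling_empty_iff]
    · rw [setOf_isPeeling_eq hne]
      refine (hP.subset extremePoints_convexHull_subset).biUnion fun v hv => ?_
      have hv := extremePoints_convexHull_subset hv
      exact (ih _ (h ▸ ncard_diff_singleton_lt hP hv) hP.sdiff rfl).image _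

/-- Peeling sequences are counted according to their first point. -/
theorem peelingCount_eq_sum {P : Set ℂ} (hP : P.Finite) (hne : P.Nonempty) (V : Finset ℂ)
    (hV : (V : Set ℂ) = (convexHull ℝ P).extremePoints ℝ) :
    peelingCount P = ∑ v ∈ V, peelingCount (P \ {v}) := by
  classical
  have hfin : ∀ v, {l | IsPeeling (P \ {v}) l}.Finite := fun v => finite_setOf_isPeeling hP.sdiff
  have hset : {l | IsPeeling P l} =
      ((V.biUnion fun v => (hfin v).toFinset.image (List.cons v) : Finset (List ℂ)) :
        Set (List ℂ)) := by
    rw [setOf_isPeeling_eq hne, ← hV]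
    ext l
    simp
  rw [peelingCount, hset, Set.ncard_coe_finset, Finset.card_biUnion]
  · refine Finset.sum_congr rfl fun v _ => ?_
    rw [Finset.card_image_of_injective _ (List.cons_injective), peelingCount,
      Set.ncard_eq_toFinset_card _ (hfin v)]
  · intro v _ w _ hvw
    rw [Function.onFun, Finset.disjoint_left]
    intro l hl hl'
    obtain ⟨l₁, _, rfl⟩ := Finset.mem_image.1 hl
    obtain ⟨l₂, _, h⟩ := Finset.mem_image.1 hl'
    exact hvw (List.cons.inj h).1.symm

/-- The vertices of the convex hull of a finite set. -/
theorem exists_finset_vertices {P : Set ℂ} (hP : P.Finite) :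
    ∃ V : Finset ℂ, (V : Set ℂ) = (convexHull ℝ P).extremePoints ℝ :=
  (hP.subset extremePoints_convexHull_subset).exists_finset_coe

/-- An overestimate of the vertex set suffices for upper bounds, so it never has to be decided which
candidates really are vertices. -/
theorem peelingCount_le_sum {P : Set ℂ} (hP : P.Finite) (hne : P.Nonempty) (V : Finset ℂ)
    (hV : (convexHull ℝ P).extremePoints ℝ ⊆ V) :
    peelingCount P ≤ ∑ v ∈ V, peelingCount (P \ {v}) := by
  obtain ⟨W, hW⟩ := exists_finset_vertices hP
  rw [peelingCount_eq_sum hP hne W hW]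
  exact Finset.sum_le_sum_of_subset (by rw [← Finset.coe_subset, hW]; exact hV)

theorem peelingCount_le_factorial {P : Set ℂ} (hP : P.Finite) :
    peelingCount P ≤ P.ncard.factorial := by
  induction h : P.ncard generalizing P with
  | zero =>
    rw [Set.ncard_eq_zero hP] at h
    simp [h, peelingCount_empty]
  | succ k ih =>
    have hne : P.Nonempty := by
      rw [← Set.ncard_pos hP]
      omega
    refine (peelingCount_le_sum hP hne hP.toFinset
      (by simpa using extremePoints_convexHull_subset)).trans ?_
    have : ∀ v ∈ hP.toFinset, peelingCount (P \ {v}) ≤ k.factorial := by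
      intro v hv
      apply ih hP.sdiff
      rw [Set.ncard_sdiff_singleton_of_mem (hP.mem_toFinset.1 hv), h]
      rfl
    refine (Finset.sum_le_card_nsmul _ _ _ this).trans ?_
    rw [← Set.ncard_eq_toFinset_card P hP, h, smul_eq_mul, Nat.factorial_succ]

/-- This is why a peeling sequence of a set induces peeling sequences of its subsets. -/
theorem extremePoint_of_subset {A P : Set ℂ} (h : A ⊆ P) {v : ℂ} (hv : v ∈ A)
    (hP : v ∈ (convexHull ℝ P).extremePoints ℝ) : v ∈ (convexHull ℝ A).extremePoints ℝ :=
  inter_extremePoints_subset_extremePoints_of_subset (convexHull_mono h)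
    ⟨subset_convexHull ℝ A hv, hP⟩

theorem sum_peelingCount_le {A : Set ℂ} (hA : A.Finite) (V : Finset ℂ)
    (hV : (V : Set ℂ) ⊆ (convexHull ℝ A).extremePoints ℝ) :
    ∑ v ∈ V, peelingCount (A \ {v}) ≤ peelingCount A := by
  rcases A.eq_empty_or_nonempty with rfl | hne
  · have : V = ∅ := by simpa using hV
    simp [this]
  · obtain ⟨W, hW⟩ := exists_finset_vertices hA
    rw [peelingCount_eq_sum hA hne W hW]
    exact Finset.sum_le_sum_of_subset (by rw [← Finset.coe_subset, hW]; exact hV)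

/-- A peeling sequence of a union is determined by the peeling sequences that it induces on the two
parts, and by their interleaving. -/
theorem peelingCount_union_le {A B : Set ℂ} (hA : A.Finite) (hB : B.Finite) (hAB : Disjoint A B) :
    peelingCount (A ∪ B) ≤ 2 ^ (A.ncard + B.ncard) * (peelingCount A * peelingCount B) := by
  classical
  induction h : A.ncard + B.ncard using Nat.strong_induction_on generalizing A B with
  | _ k ih =>
  rcases (A ∪ B).eq_empty_or_nonempty with he | hne
  · obtain ⟨rfl, rfl⟩ := Set.union_empty_iff.1 he
    simp at h
    simp [peelingCount_empty, Nat.one_le_two_pow]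
  obtain ⟨V, hV⟩ := exists_finset_vertices (hA.union hB)
  have hVAB : ∀ v ∈ V, v ∈ A ∪ B := fun v hv =>
    extremePoints_convexHull_subset (hV ▸ (Finset.mem_coe.2 hv))
  have hk : 0 < k := by
    have := (Set.ncard_pos (hA.union hB)).2 hne
    rw [Set.ncard_union_eq hAB hA hB] at this
    omega
  -- A hull vertex of the union that lies in `A` is a hull vertex of `A`, so summing over these
  -- vertices gives at most `peelingCount A`. The halves for `A` and `B` contribute `2 ^ (k - 1)`
  -- each.
  have hAsum : ∑ v ∈ V.filter (· ∈ A), peelingCount ((A ∪ B) \ {v}) ≤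
      2 ^ (k - 1) * (peelingCount A * peelingCount B) := by
    calc _ ≤ ∑ v ∈ V.filter (· ∈ A),
          2 ^ (k - 1) * (peelingCount (A \ {v}) * peelingCount B) := by
          refine Finset.sum_le_sum fun v hv => ?_
          have hvA := (Finset.mem_filter.1 hv).2
          have hvB : v ∉ B := hAB.notMem_of_mem_left hvA
          have hc : (A \ {v}).ncard + 1 = A.ncard := Set.ncard_sdiff_singleton_add_one hvA hA
          rw [Set.union_sdiff_distrib, Set.sdiff_singleton_eq_self hvB]
          exact ih _ (by omega) hA.sdiff hB (hAB.mono_left Set.sdiff_subset) (by omega)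
      _ ≤ _ := by
          rw [← Finset.mul_sum, ← Finset.sum_mul]
          gcongr
          apply sum_peelingCount_le hA
          intro v hv
          simp only [Finset.coe_filter, Set.mem_ofPred_eq] at hv
          exact extremePoint_of_subset Set.subset_union_left hv.2 (hV ▸ Finset.mem_coe.2 hv.1)
  have hBsum : ∑ v ∈ V.filter (¬ · ∈ A), peelingCount ((A ∪ B) \ {v}) ≤
      2 ^ (k - 1) * (peelingCount A * peelingCount B) := by
    calc _ ≤ ∑ v ∈ V.filter (¬ · ∈ A),
          2 ^ (k - 1) * (peelingCount A * peelingCount (B \ {v})) := by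
          refine Finset.sum_le_sum fun v hv => ?_
          have hvA := (Finset.mem_filter.1 hv).2
          have hvB : v ∈ B := (hVAB v (Finset.mem_filter.1 hv).1).resolve_left hvA
          have hc : (B \ {v}).ncard + 1 = B.ncard := Set.ncard_sdiff_singleton_add_one hvB hB
          rw [Set.union_sdiff_distrib, Set.sdiff_singleton_eq_self hvA]
          exact ih _ (by omega) hA hB.sdiff (hAB.mono_right Set.sdiff_subset) (by omega)
      _ ≤ _ := by
          rw [← Finset.mul_sum, ← Finset.mul_sum]
          gcongr
          apply sum_peelingCount_le hB
          intro v hv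
          simp only [Finset.coe_filter, Set.mem_ofPred_eq] at hv
          exact extremePoint_of_subset Set.subset_union_right
            ((hVAB v hv.1).resolve_left hv.2) (hV ▸ Finset.mem_coe.2 hv.1)
  rw [peelingCount_eq_sum (hA.union hB) hne V hV, ← Finset.sum_filter_add_sum_filter_not V (· ∈ A)]
  refine (add_le_add hAsum hBsum).trans_eq ?_
  obtain ⟨k, rfl⟩ : ∃ j, k = j + 1 := ⟨k - 1, by omega⟩
  simp only [Nat.add_sub_cancel]
  ring

theorem extremePoint_of_image {f : ℂ →ᵃ[ℝ] ℂ} (hf : Function.Injective f) {P : Set ℂ} {v : ℂ}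
    (h : f v ∈ (convexHull ℝ (f '' P)).extremePoints ℝ) :
    v ∈ (convexHull ℝ P).extremePoints ℝ := by
  rw [← AffineMap.image_convexHull] at h
  refine ⟨by obtain ⟨w, hw, hwv⟩ := h.1; exact hf hwv ▸ hw, fun x hx y hy hv => ?_⟩
  refine hf (h.2 (Set.mem_image_of_mem f hx) (Set.mem_image_of_mem f hy) ?_)
  rw [← image_openSegment]
  exact Set.mem_image_of_mem f hv

theorem peelingCount_image_le {f : ℂ →ᵃ[ℝ] ℂ} (hf : Function.Injective f) {P : Set ℂ}
    (hP : P.Finite) : peelingCount (f '' P) ≤ peelingCount P := by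
  classical
  induction h : P.ncard using Nat.strong_induction_on generalizing P with
  | _ k ih =>
  rcases P.eq_empty_or_nonempty with rfl | hne
  · simp
  obtain ⟨V, hV⟩ := exists_finset_vertices hP
  rw [peelingCount_eq_sum hP hne V hV]
  refine (peelingCount_le_sum (hP.image f) (hne.image f) (V.image f) ?_).trans ?_
  · intro w hw
    obtain ⟨v, -, rfl⟩ := extremePoints_convexHull_subset hw
    have := extremePoint_of_image hf hw
    rw [← hV] at this
    simpa using ⟨v, this, rfl⟩
  · rw [Finset.sum_image hf.injOn]
    refine Finset.sum_le_sum fun v hv => ?_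
    have hvP : v ∈ P := extremePoints_convexHull_subset (hV ▸ Finset.mem_coe.2 hv)
    rw [← Set.image_singleton, ← Set.image_sdiff hf]
    exact ih _ (h ▸ ncard_diff_singleton_lt hP hvP) hP.sdiff rfl

/-! ### Geometry of the three rays and the triangle of outermost points. -/

theorem rayDir_zero : rayDir 0 = 1 := by simp [rayDir]

theorem rayDir_add_one (i : Fin 3) : rayDir (i + 1) = rayDir i * rayDir 1 := by
  unfold rayDir
  rw [← Complex.exp_add]
  fin_cases i
  · simp
  · congr 1
    simp
    ring
  · rw [← Complex.exp_periodic.sub_eq]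
    congr 1
    simp
    ring

theorem rayDir_add_two (i : Fin 3) : rayDir (i + 2) = rayDir i * rayDir 2 := by
  have h2 : rayDir 2 = rayDir 1 * rayDir 1 := rayDir_add_one 1
  have : i + 2 = i + 1 + 1 := by fin_cases i <;> rfl
  rw [this, rayDir_add_one, rayDir_add_one, h2, mul_assoc]

theorem rayDir_one : rayDir 1 = ⟨-1 / 2, -(√3 / 2)⟩ := by
  have h : 2 * Real.pi / 3 = Real.pi - Real.pi / 3 := by ring
  apply Complex.ext
  · simp [rayDir, Complex.exp_re, h]
    norm_num
  · simp [rayDir, Complex.exp_im, h]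

theorem rayDir_two : rayDir 2 = ⟨-1 / 2, √3 / 2⟩ := by
  have h2 : rayDir 2 = rayDir 1 * rayDir 1 := rayDir_add_one 1
  have h3 : √3 * √3 = 3 := Real.mul_self_sqrt (by norm_num)
  rw [h2, rayDir_one]
  apply Complex.ext
  · simp only [Complex.mul_re]
    linarith
  · simp only [Complex.mul_im]
    ring

theorem norm_rayDir (i : Fin 3) : ‖rayDir i‖ = 1 := by
  rw [rayDir, ← Complex.ofReal_neg, Complex.norm_exp_ofReal_mul_I]

theorem rayDir_ne_zero (i : Fin 3) : rayDir i ≠ 0 := Complex.exp_ne_zero _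

theorem norm_rayDir_mul (i : Fin 3) (w : ℂ) : ‖rayDir i * w‖ = ‖w‖ := by
  rw [norm_mul, norm_rayDir, one_mul]

section Position

variable {r : ℝ} {w : ℂ} (hw : 2 * ‖w‖ ≤ r)
include hw

theorem half_le_re_add : r / 2 ≤ ((r : ℂ) + w).re := by
  have := (abs_le.1 (Complex.abs_re_le_norm w)).1
  simp only [Complex.add_re, Complex.ofReal_re]
  linarith

theorem re_rayDir_mul_nonpos {j : Fin 3} (hj : j ≠ 0) : (rayDir j * ((r : ℂ) + w)).re ≤ 0 := by
  have h := Complex.re_le_norm (rayDir j * w)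
  rw [norm_rayDir_mul] at h
  have hre : (rayDir j).re = -1 / 2 := by
    fin_cases j
    · exact absurd rfl hj
    · exact congrArg Complex.re rayDir_one
    · exact congrArg Complex.re rayDir_two
  rw [mul_add, Complex.add_re, Complex.re_mul_ofReal, hre]
  linarith

/-- The base point lies `√3 / 2 * r ≥ 0.865 * r` below the axis and `w` shifts it by at most `r /
2`, which leaves more than `0.36 * r`. -/
theorem im_rayDir_one_mul_le : (rayDir 1 * ((r : ℂ) + w)).im ≤ -(9 / 25 * r) := by
  have h := (abs_le.1 (Complex.abs_im_le_norm (rayDir 1 * w))).2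
  have h0 := norm_nonneg w
  rw [norm_rayDir_mul] at h
  have h3 : (1.73 : ℝ) ≤ √3 := Real.le_sqrt_of_sq_le (by norm_num)
  have him : (rayDir 1).im = -(√3 / 2) := congrArg Complex.im rayDir_one
  rw [mul_add, Complex.add_im, Complex.im_mul_ofReal, him]
  nlinarith

theorem le_im_rayDir_two_mul : 9 / 25 * r ≤ (rayDir 2 * ((r : ℂ) + w)).im := by
  have h := (abs_le.1 (Complex.abs_im_le_norm (rayDir 2 * w))).1
  have h0 := norm_nonneg w
  rw [norm_rayDir_mul] at h
  have h3 : (1.73 : ℝ) ≤ √3 := Real.le_sqrt_of_sq_le (by norm_num)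
  have him : (rayDir 2).im = √3 / 2 := congrArg Complex.im rayDir_two
  rw [mul_add, Complex.add_im, Complex.im_mul_ofReal, him]
  nlinarith

theorem neg_le_re_rayDir_mul (j : Fin 3) : -(3 / 2 * r) ≤ (rayDir j * ((r : ℂ) + w)).re := by
  have h := (abs_le.1 (Complex.abs_re_le_norm (rayDir j * ((r : ℂ) + w)))).1
  have h0 := norm_nonneg w
  rw [norm_rayDir_mul] at h
  have h1 := norm_add_le (r : ℂ) w
  rw [Complex.norm_real, Real.norm_of_nonneg (by linarith)] at h1
  linarith

theorem re_add_le : ((r : ℂ) + w).re ≤ 3 / 2 * r := by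
  have := Complex.re_le_norm w
  simp only [Complex.add_re, Complex.ofReal_re]
  linarith

end Position

/-- Barycentric coordinates without normalization, so that areas can be used as weights. -/
theorem Convex.mem_of_triangle {T : Set ℂ} (hT : Convex ℝ T) {a b c x : ℂ} (ha : a ∈ T)
    (hb : b ∈ T) (hc : c ∈ T) {s t u : ℝ} (hs : 0 < s) (ht : 0 ≤ t) (hu : 0 ≤ u)
    (h : (s + t + u) • x = s • a + t • b + u • c) : x ∈ T := by
  have hpos : 0 < s + t + u := by positivity
  have hx : x = (s / (s + t + u)) • a + (t / (s + t + u)) • b + (u / (s + t + u)) • c := by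
    rw [← inv_smul_smul₀ hpos.ne' x, h]
    simp only [smul_add, smul_smul, div_eq_inv_mul]
  have key := hT.sum_mem (t := Finset.univ) (w := ![s / (s + t + u), t / (s + t + u),
    u / (s + t + u)]) (z := ![a, b, c]) (by
      intro i _
      fin_cases i <;> simp <;> positivity) (by
      simp [Fin.sum_univ_three]
      field_simp) (by
      intro i _
      fin_cases i <;> simp [ha, hb, hc])
  rw [hx]
  simpa [Fin.sum_univ_three] using key

/-- Each coefficient is twice the signed area of the triangle formed by `x` and the two other
vertices. -/
theorem triangle_identity (a b c x : ℂ) :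
    (((c - x).re * (b - x).im - (c - x).im * (b - x).re) +
      ((a - x).re * (c - x).im - (a - x).im * (c - x).re) +
      ((b - x).re * (a - x).im - (b - x).im * (a - x).re)) • x =
    ((c - x).re * (b - x).im - (c - x).im * (b - x).re) • a +
      ((a - x).re * (c - x).im - (a - x).im * (c - x).re) • b +
      ((b - x).re * (a - x).im - (b - x).im * (a - x).re) • c := by
  apply Complex.ext <;>
  · simp
    ring

/-- A point close to ray `i`, and closer to the origin than the point `t i` placed there, lies in
the triangle formed by the points `t k` placed on the three rays. -/
theorem inner_mem_of_convex {d : Fin 3 → ℝ} (hd : ∀ k, 0 < d k) {t : Fin 3 → ℂ}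
    (ht : ∀ k, 2 * ‖t k‖ ≤ d k) {i : Fin 3} {z : ℂ} (hz : 2 * ‖z‖ ≤ d i)
    (hre : z.re ≤ (t i).re) (him : ∀ k, |z.im| ≤ d k / 100)
    (hflat : ∀ k, |(t i).im - z.im| * (100 * (d i + d k)) ≤ d k * (3 * ((t i).re - z.re)))
    {T : Set ℂ} (hT : Convex ℝ T) (htT : ∀ k, placeOnRay k (d k) (t k) ∈ T) :
    placeOnRay i (d i) z ∈ T := by
  have hj : ∀ k, |z.im| * 100 ≤ d k := fun k => by linarith [him k]
  -- Coordinates rotated back by `rayDir i`: ray `i` becomes the positive real axis, with the other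
  -- two rays at 120 degrees below and above it.
  set a : ℂ := d i + t i with ha
  set x : ℂ := d i + z with hx
  set b : ℂ := rayDir 1 * (d (i + 1) + t (i + 1)) with hb
  set c : ℂ := rayDir 2 * (d (i + 2) + t (i + 2)) with hc
  have d0 := hd i
  have d1 := hd (i + 1)
  have d2 := hd (i + 2)
  have hxre : d i / 2 ≤ x.re := half_le_re_add hz
  have hxre' : x.re ≤ 3 / 2 * d i := re_add_le hz
  have hbre : b.re ≤ 0 := re_rayDir_mul_nonpos (ht _) (by decide)
  have hcre : c.re ≤ 0 := re_rayDir_mul_nonpos (ht _) (by decide)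
  have hbre' := neg_le_re_rayDir_mul (ht (i + 1)) 1
  have hcre' := neg_le_re_rayDir_mul (ht (i + 2)) 2
  have hbim := im_rayDir_one_mul_le (ht (i + 1))
  have hcim := le_im_rayDir_two_mul (ht (i + 2))
  rw [← hb] at hbre' hbim
  rw [← hc] at hcre' hcim
  have hxim : x.im = z.im := by simp [hx]
  have hare : a.re - x.re = (t i).re - z.re := by simp [ha, hx]
  have haim : a.im - x.im = (t i).im - z.im := by simp [ha, hx]
  have hx1 := abs_le.1 (him (i + 1))
  have hx2 := abs_le.1 (him (i + 2))
  have hf1 := hflat (i + 1)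
  have hf2 := hflat (i + 2)
  rw [← hxim] at hx1 hx2
  rw [← hare, ← haim] at hf1 hf2
  rw [← sub_nonneg, ← hare] at hre
  have key : (rayDir i * x) ∈ T := by
    refine hT.mem_of_triangle (htT i) (htT (i + 1)) (htT (i + 2))
      (s := (c - x).re * (b - x).im - (c - x).im * (b - x).re)
      (t := (a - x).re * (c - x).im - (a - x).im * (c - x).re)
      (u := (b - x).re * (a - x).im - (b - x).im * (a - x).re) ?_ ?_ ?_ ?_
    · simp only [Complex.sub_re, Complex.sub_im]
      have h1 : 0 < x.re - c.re := by linarith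
      have h2 : 0 < x.im - b.im := by linarith [hx1.1]
      have h3 : 0 < c.im - x.im := by linarith [hx2.2]
      have h4 : 0 < x.re - b.re := by linarith
      nlinarith [mul_pos h1 h2, mul_pos h3 h4]
    -- Here `7 / 20 = 9 / 25 - 1 / 100` bounds the height of `c` over `x`. The positive term is at
    -- least `0.35 * d (i + 2) * (a - x).re`, while `hf2` bounds the term with `y` by `0.045 * d (i
    -- + 2) * (a - x).re`. The third weight is symmetric.
    · simp only [Complex.sub_re, Complex.sub_im]
      set y := a.im - x.im
      have h1 : 0 ≤ x.re - c.re := by linarith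
      have h2 : x.re - c.re ≤ 3 / 2 * (d i + d (i + 2)) := by linarith
      have h3 : 7 / 20 * d (i + 2) ≤ c.im - x.im := by linarith [hx2.2]
      have h4 := mul_le_mul_of_nonneg_left h3 hre
      have h5 := mul_le_mul_of_nonneg_left h2 (abs_nonneg y)
      have h6 := mul_le_mul_of_nonneg_right (neg_abs_le y) h1
      have h7 := mul_nonneg hre d2.le
      nlinarith
    · simp only [Complex.sub_re, Complex.sub_im]
      set y := a.im - x.im
      have h1 : 0 ≤ x.re - b.re := by linarith
      have h2 : x.re - b.re ≤ 3 / 2 * (d i + d (i + 1)) := by linarith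
      have h3 : 7 / 20 * d (i + 1) ≤ x.im - b.im := by linarith [hx1.1]
      have h4 := mul_le_mul_of_nonneg_left h3 hre
      have h5 := mul_le_mul_of_nonneg_left h2 (abs_nonneg y)
      have h6 := mul_le_mul_of_nonneg_right (le_abs_self y) h1
      have h7 := mul_nonneg hre d1.le
      nlinarith
    · have h1 : placeOnRay (i + 1) (d (i + 1)) (t (i + 1)) = rayDir i * b := by
        rw [placeOnRay, rayDir_add_one, hb, mul_assoc]
      have h2 : placeOnRay (i + 2) (d (i + 2)) (t (i + 2)) = rayDir i * c := by
        rw [placeOnRay, rayDir_add_two, hc, mul_assoc]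
      rw [h1, h2, placeOnRay, ← ha, ← mul_smul_comm, triangle_identity a b c x]
      simp only [mul_add, mul_smul_comm]
  exact key

theorem placeOnRay_ne {i j : Fin 3} (hij : i ≠ j) {r s : ℝ} (hr : 0 < r) {z w : ℂ}
    (hz : 2 * ‖z‖ ≤ r) (hw : 2 * ‖w‖ ≤ s) : placeOnRay i r z ≠ placeOnRay j s w := by
  intro h
  obtain ⟨k, hk, rfl⟩ : ∃ k : Fin 3, k ≠ 0 ∧ j = i + k := ⟨j - i, by grind, by grind⟩
  have hmul : rayDir (i + k) = rayDir i * rayDir k := by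
    fin_cases k
    · exact absurd rfl hk
    · exact rayDir_add_one i
    · exact rayDir_add_two i
  rw [placeOnRay, placeOnRay, hmul, mul_assoc] at h
  have h' := congrArg Complex.re (mul_left_cancel₀ (rayDir_ne_zero i) h)
  have h1 := half_le_re_add hz
  have h2 := re_rayDir_mul_nonpos hw hk
  linarith

/-! ### Flatness forces the hull vertices to be outermost points. -/

/-- The tolerance is small compared with all ratios of placement distances. -/
def IsSmallTolerance (d : ℕ → Fin 3 → ℝ) (η : ℕ → ℝ) : Prop :=
  ∀ n, 3 ≤ n → ∀ i k, 0 < d n i → 0 < d n k → η (part n i) * (100 * (d n i + d n k)) ≤ d n k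

/-- A set of size `m` is used as a copy only in the construction of sets of size at most `3 * m +
2`, so `η m` has to satisfy finitely many conditions. -/
theorem exists_isSmallTolerance (d : ℕ → Fin 3 → ℝ) :
    ∃ η : ℕ → ℝ, (∀ n, 0 < η n) ∧ IsSmallTolerance d η := by
  classical
  let τ : ℕ × Fin 3 × Fin 3 → ℝ := fun p =>
    if 0 < d p.1 p.2.1 ∧ 0 < d p.1 p.2.2 then
      d p.1 p.2.2 / (100 * (d p.1 p.2.1 + d p.1 p.2.2)) else 1
  have hτ : ∀ p, 0 < τ p := by
    intro p
    simp only [τ]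
    split_ifs with h
    · have := h.1
      have := h.2
      positivity
    · exact one_pos
  have hne : ∀ m : ℕ, ((Finset.range (3 * m + 3)) ×ˢ
      (Finset.univ : Finset (Fin 3 × Fin 3))).Nonempty := fun m => ⟨(0, 0, 0), by simp⟩
  refine ⟨fun m => Finset.inf' _ (hne m) τ, fun m => ?_, fun n hn i k hi hk => ?_⟩
  · exact (Finset.lt_inf'_iff _).2 fun p _ => hτ p
  · have hle : Finset.inf' _ (hne (part n i)) τ ≤ τ (n, i, k) := by
      apply Finset.inf'_le
      simp only [Finset.mem_product, Finset.mem_range, Finset.mem_univ, and_true]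
      unfold part
      omega
    have hτe : τ (n, i, k) = d n k / (100 * (d n i + d n k)) := if_pos ⟨hi, hk⟩
    rw [hτe, le_div_iff₀ (by positivity)] at hle
    exact hle

section Construction

variable {u : ℝ} {d : ℕ → Fin 3 → ℝ} {ε η : ℕ → ℝ}

theorem IsConstruction.vertices_subset (h : IsConstruction u d ε η) (hη : IsSmallTolerance d η)
    {n : ℕ} (hn : 3 ≤ n) {Q : Fin 3 → Set ℂ} (hQ : ∀ i, Q i ⊆ raySet u d ε (part n i))
    {t : Fin 3 → ℂ} (ht : ∀ i, t i ∈ Q i) (hmax : ∀ i, ∀ z ∈ Q i, z.re ≤ (t i).re) :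
    (convexHull ℝ (⋃ i, placeOnRay i (d n i) '' Q i)).extremePoints ℝ ⊆
      Set.range fun i => placeOnRay i (d n i) (t i) := by
  intro x hx
  by_contra hxt
  obtain ⟨i, z, hz, rfl⟩ := by simpa using extremePoints_convexHull_subset hx
  have hd := h.d_pos n hn
  have hfar := fun i z hz => h.far n hn i z (hQ i hz)
  have hzt : z ≠ t i := by
    rintro rfl
    exact hxt ⟨i, rfl⟩
  have hz1 := h.flat _ z (hQ i hz) z (hQ i hz) (t i) (hQ i (ht i)) hzt
  have hz2 := h.flat _ (t i) (hQ i (ht i)) z (hQ i hz) (t i) (hQ i (ht i)) hzt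
  have hdist : ‖z - t i‖ ≤ d n i := by
    linarith [norm_sub_le z (t i), hfar i z hz, hfar i (t i) (ht i)]
  have hη' := fun k => hη n hn i k (hd i) (hd k)
  set e := η (part n i)
  have hpos : 0 < ‖z - t i‖ := norm_pos_iff.2 (sub_ne_zero.2 hzt)
  have he0 : 0 ≤ e := nonneg_of_mul_nonneg_left ((abs_nonneg _).trans hz1) hpos
  have hei : e * 200 ≤ 1 := by
    have := hη' i
    have hdi := hd i
    by_contra hcon
    nlinarith
  -- Flatness gives `|Δ im| ≤ 2 * e * ‖z - t i‖ ≤ 2 * e * (Δ re + |Δ im|)`. As `2 * e ≤ 1 / 100`,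
  -- the last term is absorbed by raising the factor 2 to 3.
  have him : |(t i).im - z.im| ≤ 3 * e * ((t i).re - z.re) := by
    have h1 : |(t i).im - z.im| ≤ 2 * (e * ‖z - t i‖) := by
      have := abs_sub (t i).im z.im
      linarith
    have h2 : ‖z - t i‖ ≤ ((t i).re - z.re) + |(t i).im - z.im| := by
      rw [norm_sub_rev]
      refine (Complex.norm_le_abs_re_add_abs_im _).trans_eq ?_
      rw [Complex.sub_re, Complex.sub_im, abs_of_nonneg (sub_nonneg.2 (hmax i z hz))]
    have h3 := mul_le_mul_of_nonneg_left h2 he0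
    have h4 := mul_le_mul_of_nonneg_right hei (abs_nonneg ((t i).im - z.im))
    have h5 := mul_nonneg he0 (sub_nonneg.2 (hmax i z hz))
    nlinarith
  -- Deleting an extreme point leaves the hull convex. The rest still contains the three outermost
  -- points, hence their triangle, hence the deleted point: a contradiction.
  rw [(convex_convexHull ℝ _).mem_extremePoints_iff_convex_sdiff] at hx
  have hmem : ∀ k, placeOnRay k (d n k) (t k) ∈
      convexHull ℝ (⋃ i, placeOnRay i (d n i) '' Q i) \ {placeOnRay i (d n i) z} := fun k =>
    ⟨subset_convexHull ℝ _ (Set.mem_iUnion_of_mem k (Set.mem_image_of_mem _ (ht k))),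
      fun hk => hxt ⟨k, hk⟩⟩
  refine (inner_mem_of_convex hd (fun k => hfar k (t k) (ht k)) (hfar i z hz) (hmax i z hz)
    (fun k => ?_) (fun k => ?_) hx.2 hmem).2 rfl
  · have h1 := mul_le_mul_of_nonneg_left hdist he0
    have := hη' k
    have := mul_nonneg he0 (hd k).le
    linarith
  · have hdi := hd i
    have hdk := hd k
    have h1 := mul_le_mul_of_nonneg_right him (by positivity : 0 ≤ 100 * (d n i + d n k))
    have h2 := mul_le_mul_of_nonneg_left (hη' k)
      (by linarith [hmax i z hz] : 0 ≤ 3 * ((t i).re - z.re))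
    linarith

end Construction

/-! ### The copies as affine images, and their cardinalities. -/

/-- The placement on ray `i` followed by the flattening, as an affine map. -/
noncomputable def copyMap (e : ℝ) (i : Fin 3) (r : ℝ) : ℂ →ᵃ[ℝ] ℂ where
  toFun z := flatten e (placeOnRay i r z)
  linear :=
    { toFun := fun z => flatten e (rayDir i * z)
      map_add' := by
        intro z w
        apply Complex.ext <;> simp [flatten] <;> ring
      map_smul' := by
        intro c z
        apply Complex.ext <;> simp [flatten] <;> ring }
  map_vadd' := by
    intro z w
    apply Complex.ext <;> simp [flatten, placeOnRay] <;> ring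

theorem coe_copyMap (e : ℝ) (i : Fin 3) (r : ℝ) :
    ⇑(copyMap e i r) = flatten e ∘ placeOnRay i r := rfl

/-- The flattening as an affine map. -/
noncomputable def flattenMap (e : ℝ) : ℂ →ᵃ[ℝ] ℂ where
  toFun := flatten e
  linear :=
    { toFun := flatten e
      map_add' := by
        intro z w
        apply Complex.ext <;> simp [flatten]
        ring
      map_smul' := by
        intro c z
        apply Complex.ext <;> simp [flatten]
        ring }
  map_vadd' := by
    intro z w
    apply Complex.ext <;> simp [flatten]
    ring

theorem flatten_injective {e : ℝ} (he : 0 < e) : Function.Injective (flatten e) := by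
  intro z w h
  have h1 := congrArg Complex.re h
  have h2 := congrArg Complex.im h
  exact Complex.ext h1 (mul_left_cancel₀ he.ne' h2)

theorem placeOnRay_injective (i : Fin 3) (r : ℝ) : Function.Injective (placeOnRay i r) := by
  intro z w h
  exact add_left_cancel (mul_left_cancel₀ (rayDir_ne_zero i) h)

theorem copyMap_injective {e : ℝ} (he : 0 < e) (i : Fin 3) (r : ℝ) :
    Function.Injective (copyMap e i r) :=
  (flatten_injective he).comp (placeOnRay_injective i r)

theorem raySet_eq_iUnion_copyMap (u : ℝ) (d : ℕ → Fin 3 → ℝ) (ε : ℕ → ℝ) {n : ℕ} (hn : 3 ≤ n) :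
    raySet u d ε n = ⋃ i, copyMap (ε n) i (d n i) '' raySet u d ε (part n i) := by
  obtain ⟨n, rfl⟩ := Nat.exists_eq_add_of_le' hn
  rw [raySet, Set.image_iUnion]
  simp only [coe_copyMap, Set.image_comp]

theorem part_lt_self {n : ℕ} (hn : 3 ≤ n) (i : Fin 3) : part n i < n := by
  obtain ⟨n, rfl⟩ := Nat.exists_eq_add_of_le' hn
  exact part_lt n i

theorem part_add_part_add_part (n : ℕ) : part n 0 + part n 1 + part n 2 = n := by
  simp only [part, Fin.val_zero, Fin.val_one, Fin.val_two]
  omega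

theorem finite_raySet_and_ncard_le (u : ℝ) (d : ℕ → Fin 3 → ℝ) (ε : ℕ → ℝ) (n : ℕ) :
    (raySet u d ε n).Finite ∧ (raySet u d ε n).ncard ≤ n := by
  induction n using Nat.strong_induction_on with
  | _ n ih =>
  rcases Nat.lt_or_ge n 3 with hn | hn
  · interval_cases n
    · simp [raySet]
    · simp [raySet]
    · rw [raySet]
      exact ⟨Set.toFinite _, (Set.ncard_insert_le _ _).trans_eq (by rw [Set.ncard_singleton])⟩
  · rw [raySet_eq_iUnion_copyMap u d ε hn]
    have h := fun i => ih _ (part_lt_self hn i)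
    refine ⟨Set.finite_iUnion fun i => (h i).1.image _, ?_⟩
    calc _ ≤ ∑ i, (copyMap (ε n) i (d n i) '' raySet u d ε (part n i)).ncard :=
          Set.ncard_iUnion_le_of_fintype _
      _ ≤ ∑ i, part n i :=
          Finset.sum_le_sum fun i _ => (Set.ncard_image_le (h i).1).trans (h i).2
      _ = n := by rw [Fin.sum_univ_three, part_add_part_add_part]

theorem finite_raySet (u : ℝ) (d : ℕ → Fin 3 → ℝ) (ε : ℕ → ℝ) (n : ℕ) :
    (raySet u d ε n).Finite := (finite_raySet_and_ncard_le u d ε n).1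

theorem ncard_raySet_le (u : ℝ) (d : ℕ → Fin 3 → ℝ) (ε : ℕ → ℝ) (n : ℕ) :
    (raySet u d ε n).ncard ≤ n := (finite_raySet_and_ncard_le u d ε n).2

/-! ### Solving the peeling recurrence. -/

/-- Each subset `Q` of `S` has at most `2 ^ #Q * M` peeling sequences. -/
def PeelingBound (S : Set ℂ) (M : ℝ) : Prop :=
  ∀ Q ⊆ S, (peelingCount Q : ℝ) ≤ 2 ^ Q.ncard * M

theorem PeelingBound.mono {S : Set ℂ} {M N : ℝ} (h : PeelingBound S M) (hMN : M ≤ N) :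
    PeelingBound S N := fun Q hQ => (h Q hQ).trans (by gcongr)

theorem PeelingBound.one_le {S : Set ℂ} {M : ℝ} (h : PeelingBound S M) : 1 ≤ M := by
  simpa [peelingCount_empty] using h ∅ (Set.empty_subset S)

theorem peelingBound_of_factorial {S : Set ℂ} (hS : S.Finite) {n : ℕ} (hn : S.ncard ≤ n) {M : ℝ}
    (hM : ∀ k ≤ n, (k.factorial : ℝ) ≤ 2 ^ k * M) : PeelingBound S M := by
  intro Q hQ
  refine le_trans ?_ (hM Q.ncard ((Set.ncard_le_ncard hQ hS).trans hn))
  exact_mod_cast peelingCount_le_factorial (hS.subset hQ)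

/-- A bound for the number of peeling sequences of a three-ray set, in terms of the numbers `k i`
of points on the rays and bounds `M i` for the subsets of the rays. In each of the three summands,
a point on one ray counts with a factor 2 and points on the other two rays with a factor 4;
as `1 / 2 + 1 / 4 + 1 / 4 = 1`, the summands are preserved by the peeling recurrence. -/
def rayWeight (M : Fin 3 → ℝ) (k : Fin 3 → ℕ) : ℝ :=
  2 ^ k 0 * (4 ^ k 1 * M 1) * (4 ^ k 2 * M 2) + (4 ^ k 0 * M 0) * 2 ^ k 1 * (4 ^ k 2 * M 2) +
    (4 ^ k 0 * M 0) * (4 ^ k 1 * M 1) * 2 ^ k 2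

theorem sum_rayWeight (M : Fin 3 → ℝ) {k : Fin 3 → ℕ} (hk : ∀ i, k i ≠ 0) :
    ∑ i, rayWeight M (Function.update k i (k i - 1)) = rayWeight M k := by
  obtain ⟨a, ha⟩ := Nat.exists_eq_add_one_of_ne_zero (hk 0)
  obtain ⟨b, hb⟩ := Nat.exists_eq_add_one_of_ne_zero (hk 1)
  obtain ⟨c, hc⟩ := Nat.exists_eq_add_one_of_ne_zero (hk 2)
  simp [Fin.sum_univ_three, rayWeight, Function.update_apply, ha, hb, hc]
  ring

theorem peelingCount_union_le_of_bound {S T A B : Set ℂ} {M N : ℝ} (hS : PeelingBound S M)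
    (hT : PeelingBound T N) (hSf : S.Finite) (hTf : T.Finite) (hA : A ⊆ S) (hB : B ⊆ T)
    {f g : ℂ →ᵃ[ℝ] ℂ} (hf : Function.Injective f) (hg : Function.Injective g)
    (hdisj : Disjoint (f '' A) (g '' B)) :
    (peelingCount (f '' A ∪ g '' B) : ℝ) ≤ (4 ^ A.ncard * M) * (4 ^ B.ncard * N) := by
  have hAf := hSf.subset hA
  have hBf := hTf.subset hB
  have h1 := peelingCount_union_le (hAf.image f) (hBf.image g) hdisj
  rw [Set.ncard_image_of_injective _ hf, Set.ncard_image_of_injective _ hg] at h1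
  have h2 : (peelingCount (f '' A) : ℝ) ≤ 2 ^ A.ncard * M :=
    le_trans (by exact_mod_cast peelingCount_image_le hf hAf) (hS A hA)
  have h3 : (peelingCount (g '' B) : ℝ) ≤ 2 ^ B.ncard * N :=
    le_trans (by exact_mod_cast peelingCount_image_le hg hBf) (hT B hB)
  have hM := hS.one_le
  calc (peelingCount (f '' A ∪ g '' B) : ℝ)
      ≤ 2 ^ (A.ncard + B.ncard) * (peelingCount (f '' A) * peelingCount (g '' B)) := by
        exact_mod_cast h1
    _ ≤ 2 ^ (A.ncard + B.ncard) * ((2 ^ A.ncard * M) * (2 ^ B.ncard * N)) := by gcongr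
    _ = _ := by
        rw [show (4 : ℝ) = 2 * 2 by norm_num, mul_pow, mul_pow]
        ring

section Construction

variable {u : ℝ} {d : ℕ → Fin 3 → ℝ} {ε η : ℕ → ℝ}

theorem IsConstruction.disjoint_copies (h : IsConstruction u d ε η) {n : ℕ} (hn : 3 ≤ n)
    {i j : Fin 3} (hij : i ≠ j) :
    Disjoint (copyMap (ε n) i (d n i) '' raySet u d ε (part n i))
      (copyMap (ε n) j (d n j) '' raySet u d ε (part n j)) := by
  rw [Set.disjoint_left]
  rintro _ ⟨z, hz, rfl⟩ ⟨w, hw, hwz⟩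
  exact placeOnRay_ne hij (h.d_pos n hn i) (h.far n hn i z hz) (h.far n hn j w hw)
    (flatten_injective (h.eps_pos n hn) hwz).symm

theorem IsConstruction.vertices_subset_copyMap (h : IsConstruction u d ε η)
    (hη : IsSmallTolerance d η) {n : ℕ} (hn : 3 ≤ n) {Q : Fin 3 → Set ℂ}
    (hQ : ∀ i, Q i ⊆ raySet u d ε (part n i)) {t : Fin 3 → ℂ} (ht : ∀ i, t i ∈ Q i)
    (hmax : ∀ i, ∀ z ∈ Q i, z.re ≤ (t i).re) :
    (convexHull ℝ (⋃ i, copyMap (ε n) i (d n i) '' Q i)).extremePoints ℝ ⊆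
      Set.range fun i => copyMap (ε n) i (d n i) (t i) := by
  intro x hx
  have himage : ⋃ i, copyMap (ε n) i (d n i) '' Q i =
      flattenMap (ε n) '' ⋃ i, placeOnRay i (d n i) '' Q i := by
    rw [Set.image_iUnion]
    simp only [coe_copyMap, Set.image_comp]
    rfl
  rw [himage] at hx
  obtain ⟨z, -, rfl⟩ := extremePoints_convexHull_subset hx
  have hz := extremePoint_of_image (flatten_injective (h.eps_pos n hn)) hx
  obtain ⟨i, rfl⟩ := h.vertices_subset hη hn hQ ht hmax hz
  exact ⟨i, rfl⟩

/-- Induction on the number of points. While all rays are occupied, `sum_rayWeight` matches the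
three-vertex recurrence; an empty ray is the boundary case. -/
theorem IsConstruction.peelingCount_le_rayWeight (h : IsConstruction u d ε η)
    (hη : IsSmallTolerance d η) {n : ℕ} (hn : 3 ≤ n) {M : Fin 3 → ℝ}
    (hM : ∀ i, PeelingBound (raySet u d ε (part n i)) (M i)) {Q : Fin 3 → Set ℂ}
    (hQ : ∀ i, Q i ⊆ raySet u d ε (part n i)) :
    (peelingCount (⋃ i, copyMap (ε n) i (d n i) '' Q i) : ℝ) ≤
      rayWeight M fun i => (Q i).ncard := by
  classical
  have hfin := fun i => finite_raySet u d ε (part n i)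
  have hQf := fun i => (hfin i).subset (hQ i)
  have hinj := fun i => copyMap_injective (h.eps_pos n hn) i (d n i)
  induction hk : ∑ i, (Q i).ncard using Nat.strong_induction_on generalizing Q with
  | _ k ih =>
  have hdisj : ∀ i j, i ≠ j →
      Disjoint (copyMap (ε n) i (d n i) '' Q i) (copyMap (ε n) j (d n j) '' Q j) :=
    fun i j hij => (h.disjoint_copies hn hij).mono (Set.image_mono (hQ i)) (Set.image_mono (hQ j))
  by_cases hne : ∀ i, (Q i).Nonempty
  · have hmax := fun i => (hQf i).exists_maximalFor Complex.re (Q i) (hne i)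
    choose t ht using hmax
    have htQ : ∀ i, t i ∈ Q i := fun i => (ht i).1
    have hmax : ∀ i, ∀ z ∈ Q i, z.re ≤ (t i).re := fun i z hz =>
      (le_total z.re (t i).re).elim id fun hle => (ht i).2 hz hle
    set v : Fin 3 → ℂ := fun i => copyMap (ε n) i (d n i) (t i) with hv
    have hvinj : Function.Injective v := by
      intro i j hij
      by_contra hne
      exact Set.disjoint_left.1 (hdisj i j hne) ⟨t i, htQ i, rfl⟩ ⟨t j, htQ j, hij.symm⟩
    have hsub := peelingCount_le_sum (P := ⋃ i, copyMap (ε n) i (d n i) '' Q i)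
      (Set.finite_iUnion fun i => (hQf i).image _) ⟨v 0, Set.mem_iUnion.2 ⟨0, t 0, htQ 0, rfl⟩⟩
      (Finset.univ.image v) (by
        simpa using h.vertices_subset_copyMap hη hn hQ htQ hmax)
    rw [Finset.sum_image hvinj.injOn] at hsub
    have hcard : ∀ i, (Q i).ncard ≠ 0 := fun i => ((Set.ncard_pos (hQf i)).2 (hne i)).ne'
    rw [← sum_rayWeight M hcard]
    refine (Nat.cast_le.2 hsub).trans ?_
    rw [Nat.cast_sum]
    refine Finset.sum_le_sum fun i _ => ?_
    have hrem : (⋃ j, copyMap (ε n) j (d n j) '' Q j) \ {v i} =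
        ⋃ j, copyMap (ε n) j (d n j) '' Function.update Q i (Q i \ {t i}) j := by
      rw [Set.iUnion_sdiff]
      refine Set.iUnion_congr fun j => ?_
      rcases eq_or_ne j i with rfl | hji
      · rw [Function.update_self, Set.image_sdiff (hinj j), Set.image_singleton]
      · rw [Function.update_of_ne hji, Set.sdiff_singleton_eq_self]
        exact (hdisj j i hji).notMem_of_mem_right ⟨t i, htQ i, rfl⟩
    have hnc : (fun j => (Function.update Q i (Q i \ {t i}) j).ncard) =
        Function.update (fun j => (Q j).ncard) i ((Q i).ncard - 1) := by
      funext j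
      rcases eq_or_ne j i with rfl | hji
      · simp [Set.ncard_sdiff_singleton_of_mem (htQ j)]
      · simp [hji]
    have hsubset : ∀ j, Function.update Q i (Q i \ {t i}) j ⊆ raySet u d ε (part n j) := by
      intro j
      rcases eq_or_ne j i with rfl | hji
      · rw [Function.update_self]
        exact Set.sdiff_subset.trans (hQ j)
      · rw [Function.update_of_ne hji]
        exact hQ j
    rw [hrem, ← hnc]
    refine ih _ ?_ hsubset (fun j => (hfin j).subset (hsubset j)) rfl
    rw [← hk]
    refine Finset.sum_lt_sum (fun j _ => ?_) ⟨i, Finset.mem_univ i, ?_⟩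
    · refine Set.ncard_le_ncard ?_ (hQf j)
      rcases eq_or_ne j i with rfl | hji
      · rw [Function.update_self]
        exact Set.sdiff_subset
      · rw [Function.update_of_ne hji]
    · rw [Function.update_self]
      exact ncard_diff_singleton_lt (hQf i) (htQ i)
  -- If ray `i` is empty, the summand of `rayWeight` in which ray `i` has base 2 is exactly the
  -- union bound for the other two rays. The other summands are nonnegative.
  · have hM1 := fun i => (hM i).one_le
    have hM0 : ∀ i, 0 ≤ M i := fun i => zero_le_one.trans (hM1 i)
    have hpair : ∀ i j, i ≠ j → (peelingCount (copyMap (ε n) i (d n i) '' Q i ∪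
        copyMap (ε n) j (d n j) '' Q j) : ℝ) ≤
          (4 ^ (Q i).ncard * M i) * (4 ^ (Q j).ncard * M j) := fun i j hij =>
      peelingCount_union_le_of_bound (hM i) (hM j) (hfin i) (hfin j) (hQ i) (hQ j)
        (hinj i) (hinj j) (hdisj i j hij)
    have hunion : ⋃ i, copyMap (ε n) i (d n i) '' Q i = copyMap (ε n) 0 (d n 0) '' Q 0 ∪
        copyMap (ε n) 1 (d n 1) '' Q 1 ∪ copyMap (ε n) 2 (d n 2) '' Q 2 := by
      ext x
      simp [Fin.exists_fin_succ, or_assoc]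
    have m0 := hM0 0
    have m1 := hM0 1
    have m2 := hM0 2
    rw [hunion, rayWeight]
    push Not at hne
    obtain ⟨i, hi⟩ := hne
    fin_cases i
    · simp only [Fin.zero_eta] at hi
      have := hpair 1 2 (by decide)
      simp only [hi, Set.image_empty, Set.empty_union, Set.ncard_empty, pow_zero, one_mul]
      have p1 : 0 ≤ M 0 * 2 ^ (Q 1).ncard * (4 ^ (Q 2).ncard * M 2) := by positivity
      have p2 : 0 ≤ M 0 * (4 ^ (Q 1).ncard * M 1) * 2 ^ (Q 2).ncard := by positivity
      linarith
    · simp only [Fin.mk_one] at hi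
      have := hpair 0 2 (by decide)
      simp only [hi, Set.image_empty, Set.union_empty, Set.ncard_empty, pow_zero, one_mul, mul_one]
      have p1 : 0 ≤ 2 ^ (Q 0).ncard * M 1 * (4 ^ (Q 2).ncard * M 2) := by positivity
      have p2 : 0 ≤ 4 ^ (Q 0).ncard * M 0 * M 1 * 2 ^ (Q 2).ncard := by positivity
      linarith
    · simp only [Fin.reduceFinMk] at hi
      have := hpair 0 1 (by decide)
      simp only [hi, Set.image_empty, Set.union_empty, Set.ncard_empty, pow_zero, one_mul, mul_one]
      have p1 : 0 ≤ 2 ^ (Q 0).ncard * (4 ^ (Q 1).ncard * M 1) * M 2 := by positivity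
      have p2 : 0 ≤ 4 ^ (Q 0).ncard * M 0 * 2 ^ (Q 1).ncard * M 2 := by positivity
      linarith

/-- The bound for `S n` obtained from bounds for the copies on its rays. -/
theorem IsConstruction.peelingBound_of_copies (h : IsConstruction u d ε η)
    (hη : IsSmallTolerance d η) {n : ℕ} (hn : 3 ≤ n) {M : Fin 3 → ℝ}
    (hM : ∀ i, PeelingBound (raySet u d ε (part n i)) (M i)) :
    PeelingBound (raySet u d ε n)
      (2 ^ (part n 1 + part n 2) * (M 1 * M 2) + 2 ^ (part n 0 + part n 2) * (M 0 * M 2) +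
        2 ^ (part n 0 + part n 1) * (M 0 * M 1)) := by
  intro P hP
  have hfin := fun i => finite_raySet u d ε (part n i)
  have hinj := fun i => copyMap_injective (h.eps_pos n hn) i (d n i)
  set Q : Fin 3 → Set ℂ := fun i => copyMap (ε n) i (d n i) ⁻¹' P ∩ raySet u d ε (part n i)
  have hQ : ∀ i, Q i ⊆ raySet u d ε (part n i) := fun i => Set.inter_subset_right
  have hPQ : P = ⋃ i, copyMap (ε n) i (d n i) '' Q i := by
    ext x
    constructor
    · intro hx
      have hx' := hP hx
      rw [raySet_eq_iUnion_copyMap u d ε hn] at hx'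
      obtain ⟨i, z, hz, rfl⟩ := Set.mem_iUnion.1 hx'
      exact Set.mem_iUnion.2 ⟨i, z, ⟨hx, hz⟩, rfl⟩
    · intro hx
      obtain ⟨i, z, hz, rfl⟩ := Set.mem_iUnion.1 hx
      exact hz.1
  have hcard : P.ncard = (Q 0).ncard + (Q 1).ncard + (Q 2).ncard := by
    rw [hPQ, Set.ncard_iUnion_of_finite (fun i => ((hfin i).subset (hQ i)).image _),
      finsum_eq_sum_of_fintype, Fin.sum_univ_three]
    · simp only [Set.ncard_image_of_injective _ (hinj _)]
    · intro i j hij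
      exact (h.disjoint_copies hn hij).mono (Set.image_mono (hQ i)) (Set.image_mono (hQ j))
  have hk : ∀ i, (Q i).ncard ≤ part n i := fun i =>
    (Set.ncard_le_ncard (hQ i) (hfin i)).trans (ncard_raySet_le u d ε _)
  have h0 := hk 0
  have h1 := hk 1
  have h2 := hk 2
  have hM0 : ∀ i, 0 ≤ M i := fun i => zero_le_one.trans (hM i).one_le
  have m0 := hM0 0
  have m1 := hM0 1
  have m2 := hM0 2
  have hmain := h.peelingCount_le_rayWeight hη hn hM hQ
  rw [← hPQ] at hmain
  refine hmain.trans ?_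
  -- Writing `4 ^ k` as `2 ^ k * 2 ^ k` splits off `2 ^ P.ncard`. The remaining factor increases
  -- with the sizes of the `Q i`, so these may be replaced by the full sizes `part n i`.
  have hw : rayWeight M (fun i => (Q i).ncard) = 2 ^ P.ncard *
      (2 ^ ((Q 1).ncard + (Q 2).ncard) * (M 1 * M 2) +
        2 ^ ((Q 0).ncard + (Q 2).ncard) * (M 0 * M 2) +
        2 ^ ((Q 0).ncard + (Q 1).ncard) * (M 0 * M 1)) := by
    rw [rayWeight, hcard, show (4 : ℝ) = 2 * 2 by norm_num]
    simp only [mul_pow, pow_add]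
    ring
  rw [hw]
  gcongr <;> norm_num

end Construction

/-! ### Numerical induction with base `867 / 200 = 4.335`. -/

section Construction

variable {u : ℝ} {d : ℕ → Fin 3 → ℝ} {ε η : ℕ → ℝ}

/-- The bound for subsets of `S n` with `n ≤ 7` that follows from counting all orderings. -/
noncomputable def smallBound (n : ℕ) : ℝ := if n ≤ 3 then 1 else n.factorial / 2 ^ n

theorem peelingBound_smallBound (u : ℝ) (d : ℕ → Fin 3 → ℝ) (ε : ℕ → ℝ) {n : ℕ} (hn : n ≤ 7) :
    PeelingBound (raySet u d ε n) (smallBound n) := by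
  refine peelingBound_of_factorial (finite_raySet u d ε n) (ncard_raySet_le u d ε n) ?_
  intro k hk
  -- For `k ≤ 3` the maximum of `k! / 2 ^ k` is 1, attained by the empty set; for `4 ≤ n ≤ 7` the
  -- maximum over `k ≤ n` is at `k = n`.
  interval_cases n <;> interval_cases k <;> norm_num [smallBound, Nat.factorial]

/-- One of the three summands in the induction step. Nearly equal parts give `2 ^ (b + c) ≤ 4 * 4 ^
a`, which is paid for by the missing `4.335 ^ a`. The second factor `1 / 500` absorbs the 4 and the
division by 3. -/
theorem two_pow_mul_le {a b c n : ℕ} (habc : a + b + c = n) (h : b + c ≤ 2 * a + 2) :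
    (2 : ℝ) ^ (b + c) * ((867 / 200) ^ b / 500 * ((867 / 200) ^ c / 500)) ≤
      (867 / 200) ^ n / 500 / 3 := by
  have h1 : (2 : ℝ) ^ (b + c) ≤ 4 * (867 / 200) ^ a := by
    calc (2 : ℝ) ^ (b + c) ≤ 2 ^ (2 * a + 2) := by gcongr; norm_num
      _ = 4 * 4 ^ a := by
        rw [pow_add, pow_mul]
        norm_num
        ring
      _ ≤ 4 * (867 / 200) ^ a := by gcongr; norm_num
  calc (2 : ℝ) ^ (b + c) * ((867 / 200) ^ b / 500 * ((867 / 200) ^ c / 500))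
      ≤ 4 * (867 / 200) ^ a * ((867 / 200) ^ b / 500 * ((867 / 200) ^ c / 500)) := by gcongr
    _ = (867 / 200) ^ n * (4 / 250000) := by
      rw [← habc, pow_add, pow_add]
      ring
    _ ≤ (867 / 200) ^ n * (1 / 1500) :=
      mul_le_mul_of_nonneg_left (by norm_num) (by positivity)
    _ = _ := by ring

theorem IsConstruction.peelingBound (h : IsConstruction u d ε η) (hη : IsSmallTolerance d η)
    {n : ℕ} (hn : 6 ≤ n) : PeelingBound (raySet u d ε n) ((867 / 200) ^ n / 500) := by
  induction n using Nat.strong_induction_on with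
  | _ n ih =>
  rcases Nat.lt_or_ge n 8 with h8 | h8
  · refine (peelingBound_smallBound u d ε (by omega)).mono ?_
    interval_cases n <;> norm_num [smallBound, Nat.factorial]
  rcases Nat.lt_or_ge n 18 with h18 | h18
  -- For `8 ≤ n < 18` some part may be below 6, where the induction hypothesis is not available, so
  -- the factorial bounds are used for the copies.
  · have hpart : ∀ i, part n i ≤ 7 := by
      intro i
      unfold part
      omega
    refine (h.peelingBound_of_copies hη (by omega)
      fun i => peelingBound_smallBound u d ε (hpart i)).mono ?_
    interval_cases n <;> norm_num [smallBound, part, Nat.factorial]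
  · have h3 : 3 ≤ n := by omega
    refine (h.peelingBound_of_copies hη h3 fun i => ih _ (part_lt_self h3 i) ?_).mono ?_
    · unfold part
      omega
    · have hsum := part_add_part_add_part n
      have h0 : part n 0 = (n + 2) / 3 := rfl
      have h1 : part n 1 = (n + 1) / 3 := rfl
      have h2 : part n 2 = n / 3 := rfl
      have e0 := two_pow_mul_le (a := part n 0) (b := part n 1) (c := part n 2) hsum (by omega)
      have e1 := two_pow_mul_le (a := part n 1) (b := part n 0) (c := part n 2) (n := n)
        (by omega) (by omega)
      have e2 := two_pow_mul_le (a := part n 2) (b := part n 0) (c := part n 1) (n := n)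
        (by omega) (by omega)
      linarith

theorem IsConstruction.peelingCount_le (h : IsConstruction u d ε η) (hη : IsSmallTolerance d η)
    {n : ℕ} (hn : 6 ≤ n) {Q : Set ℂ} (hQ : Q ⊆ raySet u d ε n) :
    (peelingCount Q : ℝ) ≤ 8.67 ^ n / 500 := by
  have hcard : Q.ncard ≤ n :=
    (Set.ncard_le_ncard hQ (finite_raySet u d ε n)).trans (ncard_raySet_le u d ε n)
  calc (peelingCount Q : ℝ) ≤ 2 ^ Q.ncard * ((867 / 200) ^ n / 500) := h.peelingBound hη hn Q hQ
    _ ≤ 2 ^ n * ((867 / 200) ^ n / 500) := by gcongr; norm_num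
    _ = 8.67 ^ n / 500 := by
      rw [mul_div_assoc', ← mul_pow]
      norm_num

end Construction

/-! ### Existence of arbitrarily flat constructions. -/

theorem raySet_congr (u : ℝ) (d : ℕ → Fin 3 → ℝ) {ε ε' : ℕ → ℝ} {n : ℕ}
    (h : ∀ k ≤ n, ε k = ε' k) : raySet u d ε n = raySet u d ε' n := by
  induction n using Nat.strong_induction_on with
  | _ n ih =>
  rcases Nat.lt_or_ge n 3 with hn | hn
  · interval_cases n <;> simp [raySet]
  · rw [raySet_eq_iUnion_copyMap u d ε hn, raySet_eq_iUnion_copyMap u d ε' hn, h n le_rfl]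
    refine Set.iUnion_congr fun i => ?_
    rw [ih _ (part_lt_self hn i) fun k hk => h k (hk.trans (part_lt_self hn i).le)]

/-- The union of the placed copies in the construction of `S n`, before the flattening. -/
noncomputable def unflattened (u : ℝ) (d : ℕ → Fin 3 → ℝ) (ε : ℕ → ℝ) (n : ℕ) : Set ℂ :=
  ⋃ i, placedCopy u d ε n i

theorem raySet_eq_flatten_image (u : ℝ) (d : ℕ → Fin 3 → ℝ) (ε : ℕ → ℝ) {n : ℕ} (hn : 3 ≤ n) :
    raySet u d ε n = flatten (ε n) '' unflattened u d ε n := by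
  obtain ⟨n, rfl⟩ := Nat.exists_eq_add_of_le' hn
  rw [raySet]
  rfl

theorem finite_unflattened (u : ℝ) (d : ℕ → Fin 3 → ℝ) (ε : ℕ → ℝ) (n : ℕ) :
    (unflattened u d ε n).Finite :=
  Set.finite_iUnion fun i => (finite_raySet u d ε (part n i)).image _

theorem unflattened_congr (u : ℝ) (d : ℕ → Fin 3 → ℝ) {ε ε' : ℕ → ℝ} {n : ℕ} (hn : 3 ≤ n)
    (h : ∀ k < n, ε k = ε' k) : unflattened u d ε n = unflattened u d ε' n := by
  refine Set.iUnion_congr fun i => ?_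
  rw [placedCopy, placedCopy, raySet_congr u d fun k hk => h k (hk.trans_lt (part_lt_self hn i))]

open Filter Topology in
/-- A finite set without two points on a vertical line becomes arbitrarily flat. -/
theorem exists_isFlat_flatten {U : Set ℂ} (hU : U.Finite) (hre : U.InjOn Complex.re) {η : ℝ}
    (hη : 0 < η) : ∃ e : ℝ, 0 < e ∧ e ≤ 1 ∧ IsFlat η (flatten e '' U) := by
  -- Horizontal differences are unaffected by the flattening and bound distances from below; the
  -- finitely many conditions all hold for small `e`.
  have hev : ∀ᶠ e : ℝ in 𝓝[>] 0, ∀ p ∈ U, ∀ q ∈ U, ∀ q' ∈ U, q ≠ q' →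
      e * |p.im| ≤ η * |q.re - q'.re| := by
    rw [eventually_all_finite hU]
    intro p _
    rw [eventually_all_finite hU]
    intro q hq
    rw [eventually_all_finite hU]
    intro q' hq'
    rw [eventually_imp_distrib_left]
    intro hqq'
    have hpos : 0 < η * |q.re - q'.re| :=
      mul_pos hη (abs_pos.2 (sub_ne_zero.2 fun h => hqq' (hre hq hq' h)))
    have hlim : Tendsto (fun e : ℝ => e * |p.im|) (𝓝[>] 0) (𝓝 0) := by
      have : Tendsto (fun e : ℝ => e * |p.im|) (𝓝 0) (𝓝 (0 * |p.im|)) :=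
        (continuous_id.mul continuous_const).tendsto 0
      rw [zero_mul] at this
      exact this.mono_left nhdsWithin_le_nhds
    exact (hlim.eventually (gt_mem_nhds hpos)).mono fun e he => he.le
  obtain ⟨e, he, he0, he1⟩ := (hev.and (Ioc_mem_nhdsGT (zero_lt_one' ℝ))).exists
  refine ⟨e, he0, he1, ?_⟩
  rintro _ ⟨p, hp, rfl⟩ _ ⟨q, hq, rfl⟩ _ ⟨q', hq', rfl⟩ hne
  have hqq' : q ≠ q' := fun h => hne (h ▸ rfl)
  calc |(flatten e p).im| = e * |p.im| := by simp [flatten, abs_mul, abs_of_pos he0]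
    _ ≤ η * |q.re - q'.re| := he p hp q hq q' hq' hqq'
    _ ≤ η * ‖flatten e q - flatten e q'‖ := by
      gcongr
      exact Complex.abs_re_le_norm (flatten e q - flatten e q')

theorem IsFlat.mono {η η' : ℝ} (hη : η ≤ η') {P : Set ℂ} (h : IsFlat η P) : IsFlat η' P :=
  fun p hp q hq q' hq' hne => (h p hp q hq q' hq' hne).trans (by gcongr)

/-- Flat sets do not contain two points on a line of the direction of a ray. -/
theorem IsFlat.injOn_re_placeOnRay {P : Set ℂ} (h : IsFlat (1 / 10) P) (i : Fin 3) (r : ℝ) :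
    P.InjOn fun z => (placeOnRay i r z).re := by
  intro z hz w hw hzw
  by_contra hne
  have hpos : 0 < ‖z - w‖ := norm_pos_iff.2 (sub_ne_zero.2 hne)
  have h1 := h z hz z hz w hw hne
  have h2 := h w hw z hz w hw hne
  have h3 : |(z - w).im| ≤ 1 / 5 * ‖z - w‖ := by
    have := abs_sub z.im w.im
    rw [Complex.sub_im]
    linarith
  have h4 := Complex.norm_le_abs_re_add_abs_im (z - w)
  have hzero : (rayDir i * (z - w)).re = 0 := by
    have : rayDir i * (z - w) = placeOnRay i r z - placeOnRay i r w := by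
      simp only [placeOnRay]
      ring
    rw [this, Complex.sub_re, sub_eq_zero]
    exact hzw
  set x := (z - w).re
  set y := (z - w).im
  have hs : |√3 * y| ≤ 2 * |y| := by
    rw [abs_mul, abs_of_nonneg (Real.sqrt_nonneg 3)]
    gcongr
    exact Real.sqrt_le_iff.2 ⟨by norm_num, by norm_num⟩
  -- A difference that becomes vertical after the rotation has `x = 0` or `x = ±√3 * y`. Then `‖z -
  -- w‖ ≤ 3 * |y| ≤ 3 / 5 * ‖z - w‖`, which is impossible.
  have hx : |x| ≤ 2 * |y| := by
    fin_cases i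
    · have hx0 : x = 0 := by simpa [x, rayDir_zero] using hzero
      rw [hx0, abs_zero]
      positivity
    · have hx0 : x = √3 * y := by
        simp only [Fin.mk_one, rayDir_one, Complex.mul_re] at hzero
        linarith
      rwa [hx0]
    · have hx0 : x = -(√3 * y) := by
        simp only [Fin.reduceFinMk, rayDir_two, Complex.mul_re] at hzero
        linarith
      rwa [hx0, abs_neg]
  linarith

/-- Placement distances for which the three-ray construction exists. -/
noncomputable def placementDistance (n : ℕ) (i : Fin 3) : ℝ := ![4, 4, 40] i * 100 ^ (n - 1)

theorem placementDistance_pos (n : ℕ) (i : Fin 3) : 0 < placementDistance n i := by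
  unfold placementDistance
  fin_cases i <;> simp

theorem norm_flatten_le {e : ℝ} (he : 0 < e) (he1 : e ≤ 1) (z : ℂ) : ‖flatten e z‖ ≤ ‖z‖ := by
  rw [← sq_le_sq₀ (norm_nonneg _) (norm_nonneg _), Complex.sq_norm, Complex.sq_norm,
    Complex.normSq_apply, Complex.normSq_apply]
  simp only [flatten]
  have h1 : e * e ≤ 1 := mul_le_one₀ he1 he.le he1
  nlinarith [mul_self_nonneg z.im]

section Distances

variable {ε : ℕ → ℝ} {n : ℕ}

theorem norm_le_of_mem_raySet (hε : ∀ k ≤ n, 3 ≤ k → 0 < ε k ∧ ε k ≤ 1) {z : ℂ}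
    (hz : z ∈ raySet 1 placementDistance ε n) : ‖z‖ ≤ 100 ^ n := by
  induction n using Nat.strong_induction_on generalizing z with
  | _ n ih =>
  rcases Nat.lt_or_ge n 3 with hn | hn
  · interval_cases n
    · simp [raySet] at hz
    · have hz0 : z = 0 := by simpa [raySet] using hz
      simp [hz0]
    · have hz0 : z = 0 ∨ z = 1 := by simpa [raySet] using hz
      rcases hz0 with rfl | rfl <;> norm_num
  · rw [raySet_eq_iUnion_copyMap _ _ _ hn] at hz
    obtain ⟨i, w, hw, rfl⟩ := Set.mem_iUnion.1 hz
    have hlt := part_lt_self hn i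
    have hwn := ih _ hlt (fun k hk => hε k (hk.trans hlt.le)) hw
    have hle : (100 : ℝ) ^ part n i ≤ 100 ^ (n - 1) := by
      gcongr
      · norm_num
      · omega
    have hpow : (100 : ℝ) ^ n = 100 ^ (n - 1) * 100 := by
      rw [← pow_succ]
      congr 1
      omega
    have h0 : (0 : ℝ) < 100 ^ (n - 1) := by positivity
    have hd : placementDistance n i ≤ 40 * 100 ^ (n - 1) := by
      unfold placementDistance
      gcongr
      fin_cases i <;> simp <;> norm_num
    refine (norm_flatten_le (hε n le_rfl hn).1 (hε n le_rfl hn).2 _).trans ?_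
    rw [placeOnRay, norm_rayDir_mul]
    refine (norm_add_le _ _).trans ?_
    rw [Complex.norm_real, Real.norm_of_nonneg (placementDistance_pos n i).le]
    -- The norm is at most `(40 + 1) * 100 ^ (n - 1)`.
    linarith

theorem norm_le_of_mem_raySet_part (hn : 3 ≤ n) (hε : ∀ k < n, 3 ≤ k → 0 < ε k ∧ ε k ≤ 1)
    {i : Fin 3} {z : ℂ} (hz : z ∈ raySet 1 placementDistance ε (part n i)) :
    ‖z‖ ≤ 100 ^ (n - 1) := by
  have hlt := part_lt_self hn i
  refine (norm_le_of_mem_raySet (fun k hk => hε k (hk.trans_lt hlt)) hz).trans ?_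
  gcongr
  · norm_num
  · omega

theorem two_mul_norm_le_placementDistance (hn : 3 ≤ n)
    (hε : ∀ k < n, 3 ≤ k → 0 < ε k ∧ ε k ≤ 1) {i : Fin 3} {z : ℂ}
    (hz : z ∈ raySet 1 placementDistance ε (part n i)) : 2 * ‖z‖ ≤ placementDistance n i := by
  have h := norm_le_of_mem_raySet_part hn hε hz
  have h0 : (0 : ℝ) < 100 ^ (n - 1) := by positivity
  have hd : 4 * 100 ^ (n - 1) ≤ placementDistance n i := by
    unfold placementDistance
    gcongr
    fin_cases i <;> simp; norm_num
  linarith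

theorem re_lt_of_mem_placedCopy_zero_one (hn : 3 ≤ n)
    (hε : ∀ k < n, 3 ≤ k → 0 < ε k ∧ ε k ≤ 1) {z w : ℂ}
    (hz : z ∈ placedCopy 1 placementDistance ε n 0)
    (hw : w ∈ placedCopy 1 placementDistance ε n 1) : w.re < z.re := by
  obtain ⟨z, hz, rfl⟩ := hz
  obtain ⟨w, hw, rfl⟩ := hw
  have h1 := half_le_re_add (two_mul_norm_le_placementDistance hn hε hz)
  have h2 := re_rayDir_mul_nonpos (two_mul_norm_le_placementDistance hn hε hw)
    (j := 1) (by decide)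
  have := placementDistance_pos n 0
  rw [placeOnRay, placeOnRay, rayDir_zero, one_mul]
  linarith

theorem re_lt_of_mem_placedCopy_one_two (hn : 3 ≤ n)
    (hε : ∀ k < n, 3 ≤ k → 0 < ε k ∧ ε k ≤ 1) {z w : ℂ}
    (hz : z ∈ placedCopy 1 placementDistance ε n 1)
    (hw : w ∈ placedCopy 1 placementDistance ε n 2) : w.re < z.re := by
  obtain ⟨z, hz, rfl⟩ := hz
  obtain ⟨w, hw, rfl⟩ := hw
  -- In units of `100 ^ (n - 1)`, the copy on ray 1 has real parts at least `-6` and the copy on ray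
  -- 2 at most `-20 + 1`; this is what the factor 40 is for.
  have h1 := neg_le_re_rayDir_mul (two_mul_norm_le_placementDistance hn hε hz) 1
  have h2 := Complex.re_le_norm (rayDir 2 * w)
  have h3 := norm_le_of_mem_raySet_part hn hε hw
  have h0 : (0 : ℝ) < 100 ^ (n - 1) := by positivity
  have hd1 : placementDistance n 1 = 4 * 100 ^ (n - 1) := rfl
  have hd2 : placementDistance n 2 = 40 * 100 ^ (n - 1) := rfl
  have hre : (rayDir 2).re = -1 / 2 := congrArg Complex.re rayDir_two
  rw [norm_rayDir_mul] at h2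
  rw [placeOnRay, placeOnRay, mul_add (rayDir 2), Complex.add_re, Complex.re_mul_ofReal, hre]
  linarith

theorem injOn_re_unflattened (hn : 3 ≤ n) (hε : ∀ k < n, 3 ≤ k → 0 < ε k ∧ ε k ≤ 1)
    (hflat : ∀ k < n, IsFlat (1 / 10) (raySet 1 placementDistance ε k)) :
    (unflattened 1 placementDistance ε n).InjOn Complex.re := by
  have key : ∀ i j, i < j → ∀ z ∈ placedCopy 1 placementDistance ε n i,
      ∀ w ∈ placedCopy 1 placementDistance ε n j, w.re < z.re := by
    intro i j hij z hz w hw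
    fin_cases i <;> fin_cases j <;> first | exact absurd hij (by decide) | skip
    · exact re_lt_of_mem_placedCopy_zero_one hn hε hz hw
    · obtain ⟨z, hz, rfl⟩ := hz
      obtain ⟨w, hw, rfl⟩ := hw
      have h1 := half_le_re_add (two_mul_norm_le_placementDistance hn hε hz)
      have h2 := re_rayDir_mul_nonpos (two_mul_norm_le_placementDistance hn hε hw)
        (j := 2) (by decide)
      have := placementDistance_pos n 0
      simp only [Fin.zero_eta, Fin.reduceFinMk, placeOnRay, rayDir_zero, one_mul] at h1 h2 ⊢
      linarith
    · exact re_lt_of_mem_placedCopy_one_two hn hε hz hw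
  intro z hz w hw hzw
  obtain ⟨i, hz⟩ := Set.mem_iUnion.1 hz
  obtain ⟨j, hw⟩ := Set.mem_iUnion.1 hw
  rcases lt_trichotomy i j with hij | rfl | hij
  · exact absurd hzw (key i j hij z hz w hw).ne'
  · obtain ⟨z', hz', rfl⟩ := hz
    obtain ⟨w', hw', rfl⟩ := hw
    rw [(hflat _ (part_lt_self hn i)).injOn_re_placeOnRay i (placementDistance n i) hz' hw' hzw]
  · exact absurd hzw (key j i hij w hw z hz).ne

end Distances

/-- Flattening factors can be chosen one after the other. -/
theorem exists_flattening_factors {η : ℕ → ℝ} (hη : ∀ n, 0 < η n) :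
    ∃ ε : ℕ → ℝ, ∀ n, (3 ≤ n → 0 < ε n ∧ ε n ≤ 1) ∧
      IsFlat (min (η n) (1 / 10)) (raySet 1 placementDistance ε n) := by
  classical
  -- The cap `1 / 10` keeps later rotated copies free of vertical pairs, so that the next flattening
  -- can succeed.
  let good : ℕ → (ℕ → ℝ) → ℝ → Prop := fun n ε e => 0 < e ∧ e ≤ 1 ∧
    IsFlat (min (η n) (1 / 10)) (flatten e '' unflattened 1 placementDistance ε n)
  let next : ∀ n : ℕ, (∀ k < n, ℝ) → ℝ := fun n prev =>
    Classical.epsilon (good n fun k => if hk : k < n then prev k hk else 1)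
  let ε : ℕ → ℝ := Nat.lt_wfRel.wf.fix next
  have hε : ∀ n, ε n = Classical.epsilon (good n fun k => if k < n then ε k else 1) :=
    fun n => Nat.lt_wfRel.wf.fix_eq next n
  refine ⟨ε, fun n => ?_⟩
  induction n using Nat.strong_induction_on with
  | _ n ih =>
  have hmin : 0 < min (η n) (1 / 10) := lt_min (hη n) (by norm_num)
  rcases Nat.lt_or_ge n 3 with hn | hn
  · refine ⟨fun h => absurd h (by omega), fun p hp q _ q' _ _ => ?_⟩
    have him : p.im = 0 := by
      interval_cases n
      · simp [raySet] at hp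
      · have hp0 : p = 0 := by simpa [raySet] using hp
        simp [hp0]
      · have hp0 : p = 0 ∨ p = 1 := by simpa [raySet] using hp
        rcases hp0 with rfl | rfl <;> simp
    rw [him, abs_zero]
    positivity
  · have hex : ∃ e, good n ε e := by
      refine exists_isFlat_flatten (finite_unflattened _ _ _ _) ?_ hmin
      exact injOn_re_unflattened hn (fun k hk => (ih k hk).1)
        fun k hk => (ih k hk).2.mono (min_le_right _ _)
    have hgood : good n ε = good n fun k => if k < n then ε k else 1 := by
      funext e
      simp only [good]
      rw [unflattened_congr 1 placementDistance hn fun k hk => (if_pos hk).symm]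
    have hspec : good n ε (ε n) := by
      rw [hε n, ← hgood]
      exact Classical.epsilon_spec hex
    exact ⟨fun _ => ⟨hspec.1, hspec.2.1⟩, raySet_eq_flatten_image _ _ _ hn ▸ hspec.2.2⟩

theorem exists_isConstruction {η : ℕ → ℝ} (hη : ∀ n, 0 < η n) :
    ∃ ε : ℕ → ℝ, IsConstruction 1 placementDistance ε η := by
  obtain ⟨ε, hε⟩ := exists_flattening_factors hη
  have hε1 : ∀ n, ∀ k < n, 3 ≤ k → 0 < ε k ∧ ε k ≤ 1 := fun _ k _ => (hε k).1
  exact ⟨ε,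
    { u_pos := one_pos
      d_pos := fun n _ i => placementDistance_pos n i
      eps_pos := fun n hn => ((hε n).1 hn).1
      far := fun n hn i z hz => two_mul_norm_le_placementDistance hn (hε1 n) hz
      order_zero_one := fun n hn z hz w hw => re_lt_of_mem_placedCopy_zero_one hn (hε1 n) hz hw
      order_one_two := fun n hn z hz w hw => re_lt_of_mem_placedCopy_one_two hn (hε1 n) hz hw
      flat := fun n => (hε n).2.mono (min_le_left _ _) }⟩

/-- Sufficiently flat three-ray constructions exist (first part), and for given placement
distances, all constructions that are sufficiently flat satisfy the bounds (second part). -/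
theorem theorem2 :
    (∃ (u : ℝ) (d : ℕ → Fin 3 → ℝ), ∀ η : ℕ → ℝ, (∀ n, 0 < η n) →
      ∃ ε : ℕ → ℝ, IsConstruction u d ε η) ∧
    ∀ (u : ℝ) (d : ℕ → Fin 3 → ℝ), ∃ η : ℕ → ℝ, (∀ n, 0 < η n) ∧
      ∀ ε : ℕ → ℝ, IsConstruction u d ε η → ∀ n : ℕ, 6 ≤ n →
        (peelingCount (raySet u d ε n) : ℝ) ≤ 9.78 ^ n / 500 ∧
        ∀ B : Set ℂ, IsB u d ε n B → (peelingCount B : ℝ) ≤ 8.67 ^ n / 500 := by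
  refine ⟨⟨1, placementDistance, fun η hη => exists_isConstruction hη⟩, fun u d => ?_⟩
  obtain ⟨η, hη, hsmall⟩ := exists_isSmallTolerance d
  refine ⟨η, hη, fun ε h n hn => ⟨?_, ?_⟩⟩
  -- The estimate for subsets already gives `8.67 ^ n / 500` here.
  · refine (h.peelingCount_le hsmall hn subset_rfl).trans ?_
    gcongr
    norm_num
  · rintro B ⟨i, k, -, rfl⟩
    exact h.peelingCount_le hsmall hn Set.sdiff_subset
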